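/- Conventions. A topos is an elementary topos. It is 2-valued if its terminal object $1$ has exactly two subobjects; supports split in it if every epimorphism $X\to U$ onto a subobject $U$ of $1$ has a section; it is boolean if every subobject is complemented. A topos $\mathcal{E}$ is precohesive over a topos $\mathcal{S}$ if there is a string of adjoint functors $F_!\dashv F^*\dashv F_*\dashv F^!$, with $F_!,F_*:\mathcal{E}\to\mathcal{S}$ and $F^*,F^!:\mathcal{S}\to\mathcal{E}$, such that $F^*$ is fully faithful, the counit of $F^*\dashv F_*$ is monic, and $F_!$ preserves finite products. A McLarty topos is a 2-valued topos in which supports split and which is precohesive over a boolean topos; an object $X$ of it is connected if $F_!X$ is terminal. An object $T$ of a cartesian closed category is atomic if the exponential functor $(-)^T$ has a right adjoint. A point of $X$ is an arrow $1\to X$. Theorem. There is a McLarty topos $\mathcal{E}$ with an atomic object $A$ that is connected and has a countably infinite number of points. More precisely, there are a category $C$ with countably many arrows and an object $t$ of $C$ such that one can take $\mathcal{E}=\mathbf{Set}^C$ (functors $C\to\mathbf{Set}$) and $A=C(t,-)$; here $A$ is connected with respect to every precohesion of $\mathcal{E}$ over a boolean topos. -/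

import Mathlib

open CategoryTheory CategoryTheory.Limits MonoidalCategory

universe u v u' v'

/-- An elementary topos: a category with finite limits and a subobject classifier that is
cartesian closed. -/
class IsElementaryTopos (E : Type u) [Category.{v} E] : Prop extends
    HasFiniteLimits E, HasSubobjectClassifier E where
  cartesianClosed : ∃ _ : CartesianMonoidalCategory E, Nonempty (MonoidalClosed E)

/-- Every subobject is complemented: every monomorphism `U ⟶ X` is one of the two injections of
a coproduct decomposition `X ≅ U + V`. -/
def IsBoolean (E : Type u) [Category.{v} E] : Prop :=
  ∀ ⦃U X : E⦄ (m : U ⟶ X) [Mono m],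
    ∃ (V : E) (n : V ⟶ X), Nonempty (IsColimit (BinaryCofan.mk m n))

/-- The terminal object has exactly two subobjects (equivalently, there are exactly two truth
values `1 ⟶ Ω`). -/
def IsTwoValued (E : Type u) [Category.{v} E] [HasTerminal E] : Prop :=
  Nat.card (Subobject (⊤_ E)) = 2

/-- Every epimorphism onto a subobject of the terminal object has a section. -/
def SupportsSplit (E : Type u) [Category.{v} E] [HasTerminal E] : Prop :=
  ∀ ⦃X U : E⦄ (e : X ⟶ U) [Epi e] [Mono (terminal.from U)], IsSplitEpi e

/-- A precohesion of `E` over the base `S`: a string of adjoint functors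
`pieces ⊣ discrete ⊣ points ⊣ codiscrete` with `discrete` fully faithful, the counit of
`discrete ⊣ points` monic, and `pieces` preserving finite products. -/
structure Precohesion (E : Type u) [Category.{v} E] (S : Type u') [Category.{v'} S] where
  pieces : E ⥤ S
  discrete : S ⥤ E
  points : E ⥤ S
  codiscrete : S ⥤ E
  piecesAdj : pieces ⊣ discrete
  pointsAdj : discrete ⊣ points
  codiscreteAdj : points ⊣ codiscrete
  full : discrete.Full
  faithful : discrete.Faithful
  mono_counit : ∀ X : E, Mono (pointsAdj.counit.app X)
  preservesFiniteProducts : PreservesFiniteProducts pieces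

/-- An object is connected if its object of pieces is terminal in the base. -/
def Precohesion.IsConnected {E : Type u} [Category.{v} E] {S : Type u'} [Category.{v'} S]
    (P : Precohesion E S) (X : E) : Prop :=
  Nonempty (IsTerminal (P.pieces.obj X))

/-- A McLarty topos: a two-valued topos in which supports split and which is precohesive over
a boolean topos. -/
class IsMcLartyTopos (E : Type u) [Category.{v} E] : Prop extends IsElementaryTopos E where
  twoValued : IsTwoValued E
  supportsSplit : SupportsSplit E
  precohesive : ∃ (S : Type u) (_ : Category.{v} S),
    IsElementaryTopos S ∧ IsBoolean S ∧ Nonempty (Precohesion E S)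

/-- An object `T` of a cartesian closed category is atomic if the exponential functor `(-)^T`
has a right adjoint. -/
def IsAtomicObject {E : Type u} [Category.{v} E] [CartesianMonoidalCategory E]
    [MonoidalClosed E] (T : E) : Prop :=
  (ihom T).IsLeftAdjoint

/-! Take for $C$ the finitely generated free models of the theory of sets with countably many
constants, and for $t$ the free model on one generator. Its initial object $I$ consists of the
constants, and every object maps to $I$. Evaluation at $I$ therefore computes global points, so the
points of $A$ are $C(t,I)$, the constants. Arrows both to and from $I$ yield
`isTwoValued_of_isInitial`, `supportsSplit_of_isInitial` and the monic counit. Binary coproducts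
make colimits over $C$ preserve finite products, and turn $(-)^A$ into precomposition with $-+t$,
which has a right adjoint. -/

open Opposite

/-! ### Elementary toposes of copresheaves and sets -/

section Copresheaf

variable {C : Type u} [SmallCategory C]

instance hasSubobjectClassifier_copresheaf : HasSubobjectClassifier (C ⥤ Type u) where
  exists_classifier := ⟨(Presheaf.classifier Cᵒᵖ).ofEquivalence
    (opOpEquivalence C).congrLeft⟩

instance isElementaryTopos_copresheaf : IsElementaryTopos (C ⥤ Type u) where
  cartesianClosed := ⟨inferInstance, ⟨inferInstance⟩⟩

theorem hasSubobjectClassifier_type : HasSubobjectClassifier (Type u) where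
  exists_classifier := ⟨(Presheaf.classifier (Discrete PUnit.{u + 1})ᵒᵖ).ofEquivalence
    ((opOpEquivalence (Discrete PUnit.{u + 1})).congrLeft.trans Functor.equiv)⟩

theorem isElementaryTopos_type : IsElementaryTopos (Type u) where
  toHasSubobjectClassifier := hasSubobjectClassifier_type
  cartesianClosed := ⟨inferInstance, ⟨inferInstance⟩⟩

theorem isBoolean_type : IsBoolean (Type u) := by
  intro U X m _
  refine ⟨((Set.range m)ᶜ : Set X), ↾Subtype.val, ?_⟩
  refine (Types.binaryCofan_isColimit_iff _).2
    ⟨(mono_iff_injective m).1 inferInstance, Subtype.val_injective, ?_⟩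
  change IsCompl (Set.range m) (Set.range (Subtype.val : ((Set.range m)ᶜ : Set X) → X))
  rw [Subtype.range_coe]
  exact isCompl_compl

end Copresheaf

/-! ### Global points, truth values and supports -/

section Pointed

variable {C : Type u} [SmallCategory C] {I : C}

/-- The copresheaf corepresented by an initial object is terminal. -/
def isTerminalCoyonedaOfIsInitial (hI : IsInitial I) : IsTerminal (coyoneda.obj (op I)) :=
  IsTerminal.ofUniqueHom (fun F => { app := fun X => ↾fun _ => hI.to X
                                     naturality := fun _ _ _ => by
                                      ext; exact hI.hom_ext _ _ })
    fun F m => by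
      ext X x
      exact hI.hom_ext _ _

/-- The global points of a copresheaf are its elements at the initial object. -/
noncomputable def terminalHomEquiv (hI : IsInitial I) (X : C ⥤ Type u) :
    (⊤_ (C ⥤ Type u) ⟶ X) ≃ X.obj I :=
  ((terminalIsTerminal.uniqueUpToIso (isTerminalCoyonedaOfIsInitial hI)).homCongr
    (Iso.refl X)).trans coyonedaEquiv

/-- An element of $X(I)$ is a global point, which gives a section. If there is none, $U$ is empty:
an element of $U$ could be pushed to $I$ along `r` and lifted through `e`. -/
theorem supportsSplit_of_isInitial (hI : IsInitial I) (r : ∀ c : C, c ⟶ I) :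
    SupportsSplit (C ⥤ Type u) := by
  intro X U e _ _
  have hU {Z : C ⥤ Type u} (f g : Z ⟶ U) : f = g :=
    (cancel_mono (terminal.from U)).1 (terminalIsTerminal.hom_ext _ _)
  by_cases hX : Nonempty (X.obj I)
  · obtain ⟨x⟩ := hX
    exact ⟨⟨⟨(isTerminalCoyonedaOfIsInitial hI).from U ≫ coyonedaEquiv.symm x, hU _ _⟩⟩⟩
  · have hempty (c : C) : IsEmpty (U.obj c) := ⟨fun u => by
      obtain ⟨x, -⟩ := (epi_iff_surjective (e.app I)).1 inferInstance (U.map (r c) u)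
      exact hX ⟨x⟩⟩
    exact ⟨⟨⟨{ app := fun c => ↾fun u => (hempty c).elim u
               naturality := fun c _ _ => by ext u; exact (hempty c).elim u }, hU _ _⟩⟩⟩

/-- Membership of the unique element at $I$ decides a subfunctor of $1$, because it propagates from
$I$ to every object and back. -/
theorem isTwoValued_of_isInitial (hI : IsInitial I) (r : ∀ c : C, c ⟶ I) :
    IsTwoValued (C ⥤ Type u) := by
  let F := ⊤_ (C ⥤ Type u)
  have hF (c : C) (x y : F.obj c) : x = y :=
    coyonedaEquiv.symm.injective (terminalIsTerminal.hom_ext _ _)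
  have x₀ : F.obj I := terminalHomEquiv hI F (𝟙 _)
  rw [IsTwoValued, ← Nat.card_congr (Subfunctor.orderIsoSubobject F).toEquiv,
    Nat.card_eq_two_iff]
  refine ⟨⊥, ⊤, fun h => ?_, Set.eq_univ_of_forall fun G => ?_⟩
  · have : x₀ ∈ (⊥ : Subfunctor F).obj I := h ▸ Set.mem_univ x₀
    exact this
  · by_cases hG : x₀ ∈ G.obj I
    · refine Or.inr ?_
      ext c x
      refine iff_of_true ?_ (Set.mem_univ x)
      rw [hF c x (F.map (hI.to c) x₀)]
      exact G.map (hI.to c) hG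
    · refine Or.inl ?_
      ext c x
      refine iff_of_false (fun hx => hG ?_) (Set.notMem_empty x)
      rw [hF I x₀ (F.map (r c) x)]
      exact G.map (r c) hx

end Pointed

/-! ### Precohesion over sets -/

section PrecohesionOverType

variable {C : Type u} [SmallCategory C] {I : C}

/-- Over a category with an initial object, the constant copresheaf functor is left adjoint to
evaluation at the initial object. -/
def constEvaluationAdjunction (hI : IsInitial I) :
    Functor.const C ⊣ (evaluation C (Type u)).obj I :=
  Adjunction.mkOfUnitCounit
    { unit := { app := fun _ => 𝟙 _ }
      counit :=
        { app := fun X =>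
            { app := fun c => X.map (hI.to c)
              naturality := fun c d f => by
                dsimp
                rw [Category.id_comp, ← X.map_comp]
                exact congrArg X.map (hI.hom_ext _ _) }
          naturality := fun X Y f => by
            ext1; ext1 c
            exact (f.naturality (hI.to c)).symm }
      left_triangle := by
        ext1; ext1 X; ext1; ext1 c
        simp
      right_triangle := by
        ext1; ext1 X
        simp }

/-- If `C` has binary coproducts and an initial object, and every object of `C` has an arrow to the
initial object, then `C ⥤ Type` is precohesive over `Type`. -/
noncomputable def precohesionType [HasBinaryCoproducts C]
    (hI : IsInitial I) (r : ∀ c : C, c ⟶ I) :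
    Precohesion (C ⥤ Type u) (Type u) where
  pieces := colim
  discrete := Functor.const C
  points := (evaluation C (Type u)).obj I
  codiscrete := evaluationRightAdjoint (Type u) I
  piecesAdj := colimConstAdj
  pointsAdj := constEvaluationAdjunction hI
  codiscreteAdj := evaluationAdjunctionLeft (Type u) I
  full := ⟨fun {X Y} f => ⟨f.app I, by
    ext1; ext1 c
    simpa using (f.naturality (hI.to c)).symm⟩⟩
  faithful := ⟨fun {X Y f g} h => congrArg (fun α => α.app I) h⟩
  mono_counit X := by
    have (c : C) : Mono (((constEvaluationAdjunction hI).counit.app X).app c) := by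
      have h : X.map (hI.to c) ≫ X.map (r c) = 𝟙 _ := by
        rw [← X.map_comp, ← X.map_id]
        exact congrArg X.map (hI.hom_ext _ _)
      exact (SplitMono.mk (X.map (r c)) h).mono
    exact NatTrans.mono_of_mono_app _
  preservesFiniteProducts :=
    -- A nonempty category with binary coproducts is sifted.
    have : Nonempty C := ⟨I⟩
    inferInstance

theorem isMcLartyTopos_of_isInitial [HasBinaryCoproducts C] (hI : IsInitial I)
    (r : ∀ c : C, c ⟶ I) : IsMcLartyTopos (C ⥤ Type u) where
  twoValued := isTwoValued_of_isInitial hI r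
  supportsSplit := supportsSplit_of_isInitial hI r
  precohesive := ⟨Type u, inferInstance, isElementaryTopos_type, isBoolean_type,
    ⟨precohesionType hI r⟩⟩

end PrecohesionOverType

/-! ### Connectedness over any boolean base -/

section Connected

variable {C : Type u} [SmallCategory C] {I : C}

/-- A corepresented copresheaf with a global point is connected for every precohesion over a
boolean topos: the induced point of its object of pieces is complemented, and the unit of
`pieces ⊣ discrete` cannot land in the complement. -/
theorem Precohesion.isConnected_coyoneda {S : Type u'} [Category.{v'} S] [IsElementaryTopos S]
    (hS : IsBoolean S) (P : Precohesion (C ⥤ Type u) S) (hI : IsInitial I) {t : C} (p : t ⟶ I) :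
    P.IsConnected (coyoneda.obj (op t)) := by
  have := P.preservesFiniteProducts
  have hT : IsTerminal (P.pieces.obj (coyoneda.obj (op I))) :=
    (isTerminalCoyonedaOfIsInitial hI).isTerminalObj P.pieces
  let y := P.pieces.map (coyoneda.map p.op)
  have : Mono y := hT.mono_from y
  obtain ⟨V, n, ⟨hc⟩⟩ := hS y
  -- The decomposition survives `P.discrete` and evaluation, hence splits a set at each object.
  have : PreservesColimitsOfSize.{0, 0} P.discrete := P.pointsAdj.leftAdjoint_preservesColimits
  have hcompl (c : C) := (Types.binaryCofan_isColimit_iff _).1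
    ⟨mapIsColimitOfPreservesOfIsColimit (P.discrete ⋙ (evaluation C (Type u)).obj c) _ _ hc⟩
  let η := P.piecesAdj.unit
  have hy (c : C) (a : I ⟶ c) : (P.discrete.map y).app c ((η.app _).app c a) =
      (η.app (coyoneda.obj (op t))).app c (p ≫ a) :=
    congrArg (fun α => α.app c a) (η.naturality (coyoneda.map p.op)).symm
  have hn (a : t ⟶ t) : (P.discrete.obj _).map p ((η.app (coyoneda.obj (op t))).app t a) =
      (η.app (coyoneda.obj (op t))).app I (a ≫ p) :=
    (NatTrans.naturality_apply (η.app (coyoneda.obj (op t))) p a).symm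
  -- If the generic element went to the complement, so would its image along `p`; but that image
  -- comes from the point.
  have hmem : (η.app (coyoneda.obj (op t))).app t (𝟙 t) ∈
      Set.range ((P.discrete.map y).app t) := by
    by_contra hη
    obtain ⟨v, hv⟩ : (η.app (coyoneda.obj (op t))).app t (𝟙 t) ∈
        Set.range ((P.discrete.map n).app t) :=
      ((hcompl t).2.2.codisjoint.top_le (Set.mem_univ _)).resolve_left hη
    have h₁ : (η.app (coyoneda.obj (op t))).app I p ∈ Set.range ((P.discrete.map y).app I) :=
      ⟨_, (hy I (𝟙 I)).trans (congrArg _ (Category.comp_id p))⟩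
    have h₂ : (η.app (coyoneda.obj (op t))).app I p ∈ Set.range ((P.discrete.map n).app I) :=
      ⟨(P.discrete.obj V).map p v, by
        rw [NatTrans.naturality_apply, hv, hn, Category.id_comp]⟩
    exact Set.disjoint_left.1 (hcompl I).2.2.disjoint h₁ h₂
  obtain ⟨x, hx⟩ := hmem
  -- By Yoneda the unit factors through the discrete image of `y`; transposing gives a section of
  -- the mono `y`.
  let u : coyoneda.obj (op t) ⟶ P.discrete.obj _ := coyonedaEquiv.symm x
  have hu : u ≫ P.discrete.map y = η.app _ := by
    apply coyonedaEquiv.injective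
    rw [coyonedaEquiv_comp, Equiv.apply_symm_apply, hx]
    rfl
  have hsplit : (P.piecesAdj.homEquiv _ _).symm u ≫ y = 𝟙 _ := by
    rw [← Adjunction.homEquiv_naturality_right_symm, hu]
    exact (Equiv.symm_apply_eq _).2 (P.piecesAdj.homEquiv_id _).symm
  have : IsSplitEpi y := ⟨⟨_, hsplit⟩⟩
  have : IsIso y := isIso_of_mono_of_isSplitEpi y
  exact ⟨hT.ofIso (asIso y)⟩

end Connected

/-! ### Atomicity of corepresentables -/

section Atomic

variable {C : Type u} [SmallCategory C] [HasBinaryCoproducts C]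

/-- Exponentiation by the copresheaf corepresented by `t` is precomposition with `- ⨿ t`. -/
noncomputable def tensorCoyonedaAdjunction (t : C) :
    tensorLeft (coyoneda.obj (op t)) ⊣
      (Functor.whiskeringLeft C C (Type u)).obj (coprod.functor.flip.obj t) :=
  Adjunction.mkOfUnitCounit
    { unit :=
        { app := fun X =>
            { app := fun c => ↾fun x => (coprod.inr, X.map coprod.inl x)
              naturality := fun c d f => by
                ext x
                refine Prod.ext ?_ ?_
                · change coprod.inr = coprod.inr ≫ coprod.map f (𝟙 t)
                  simp
                · change X.map coprod.inl (X.map f x) =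
                    X.map (coprod.map f (𝟙 t)) (X.map coprod.inl x)
                  rw [← Functor.map_comp_apply, ← Functor.map_comp_apply, coprod.inl_map] }
          naturality := fun X Y α => by
            ext c x
            refine Prod.ext rfl ?_
            let i : c ⟶ c ⨿ t := coprod.inl
            change Y.map i (α.app c x) = α.app (c ⨿ t) (X.map i x)
            exact (NatTrans.naturality_apply α i x).symm }
      counit :=
        { app := fun Y =>
            { app := fun c => ↾fun z => Y.map (coprod.desc (𝟙 c) z.1) z.2
              naturality := fun c d f => by
                have key (a : t ⟶ c) (y : Y.obj (c ⨿ t)) :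
                    Y.map (coprod.desc (𝟙 d) (a ≫ f)) (Y.map (coprod.map f (𝟙 t)) y) =
                      Y.map f (Y.map (coprod.desc (𝟙 c) a) y) := by
                  rw [← Functor.map_comp_apply, ← Functor.map_comp_apply]
                  simp
                ext z
                exact key z.1 z.2 }
          naturality := fun X Y α => by
            ext c z
            exact (NatTrans.naturality_apply α (coprod.desc (𝟙 c) z.1) z.2).symm }
      left_triangle := by
        ext X c z
        have key (a : t ⟶ c) (x : X.obj c) :
            X.map (coprod.desc (𝟙 c) a) (X.map coprod.inl x) = x := by
          rw [← Functor.map_comp_apply, coprod.inl_desc, Functor.map_id_apply]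
        exact Prod.ext (coprod.inr_desc (𝟙 c) z.1) (key z.1 z.2)
      right_triangle := by
        ext Y c y
        have key (y : Y.obj (c ⨿ t)) :
            Y.map (coprod.desc (𝟙 (c ⨿ t)) coprod.inr)
              (Y.map (coprod.map coprod.inl (𝟙 t)) y) = y := by
          rw [← Functor.map_comp_apply]
          simp
        exact key y }

/-- The right adjoint is right Kan extension along $-+t$. -/
theorem isAtomicObject_coyoneda (t : C) : IsAtomicObject (coyoneda.obj (op t)) :=
  have : (Functor.whiskeringLeft C C (Type u)).obj (coprod.functor.flip.obj t) |>.IsLeftAdjoint :=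
    ((coprod.functor.flip.obj t).ranAdjunction (Type u)).isLeftAdjoint
  Functor.isLeftAdjoint_of_iso
    ((tensorCoyonedaAdjunction t).rightAdjointUniq (ihom.adjunction (coyoneda.obj (op t))))

end Atomic

/-! ### The site of free models -/

/-- The category of finitely generated free models of the theory of sets with constants indexed by
`K`: an arrow `a ⟶ b` sends each of `a` generators to one of `b` generators or to a constant. -/
structure FreeWithConstants (K : Type) where
  rank : ℕ

namespace FreeWithConstants

variable {K : Type}

instance : SmallCategory (FreeWithConstants K) where
  Hom a b := Fin a.rank → Fin b.rank ⊕ K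
  id _ := Sum.inl
  comp f g := fun i => (f i).elim g Sum.inr
  comp_id f := by ext i; cases f i <;> simp_all
  assoc f g h := by ext i; dsimp only; generalize f i = x; cases x <;> rfl

/-- The initial free model, which consists of the constants only. -/
def isInitialZero : IsInitial (⟨0⟩ : FreeWithConstants K) :=
  IsInitial.ofUniqueHom (fun _ => Fin.elim0) fun _ _ => funext fun i => i.elim0

/-- Coproducts of free models add up the numbers of generators. -/
def binaryCofan (a b : FreeWithConstants K) : BinaryCofan a b :=
  BinaryCofan.mk (P := ⟨a.rank + b.rank⟩)
    (fun i => Sum.inl (Fin.castAdd b.rank i)) (fun i => Sum.inl (Fin.natAdd a.rank i))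

def isColimitBinaryCofan (a b : FreeWithConstants K) : IsColimit (binaryCofan a b) :=
  BinaryCofan.isColimitMk
    (fun s i => Fin.addCases (motive := fun _ => Fin s.pt.rank ⊕ K) s.inl s.inr i)
    (fun s => by funext i; exact Fin.addCases_left (motive := fun _ => Fin s.pt.rank ⊕ K) i)
    (fun s => by funext i; exact Fin.addCases_right (motive := fun _ => Fin s.pt.rank ⊕ K) i)
    (fun s m hl hr => by
      funext i
      refine Fin.addCases (fun j => ?_) (fun j => ?_) i
      · exact (congrFun hl j).trans
          (Fin.addCases_left (motive := fun _ => Fin s.pt.rank ⊕ K) j).symm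
      · exact (congrFun hr j).trans
          (Fin.addCases_right (motive := fun _ => Fin s.pt.rank ⊕ K) j).symm)

instance : HasBinaryCoproducts (FreeWithConstants K) :=
  have (a b : FreeWithConstants K) : HasColimit (pair a b) := ⟨⟨_, isColimitBinaryCofan a b⟩⟩
  hasBinaryCoproducts_of_hasColimit_pair _

instance [Countable K] : Countable (Σ a b : FreeWithConstants K, a ⟶ b) := by
  have : Countable (FreeWithConstants K) :=
    Function.Injective.countable (f := rank) fun ⟨_⟩ ⟨_⟩ h => congrArg mk h
  have (a b : FreeWithConstants K) : Countable (a ⟶ b) :=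
    inferInstanceAs (Countable (Fin a.rank → Fin b.rank ⊕ K))
  infer_instance

/-- The elements of the initial free model are the constants. -/
def homOneZeroEquiv : ((⟨1⟩ : FreeWithConstants K) ⟶ ⟨0⟩) ≃ K :=
  (Equiv.funUnique (Fin 1) _).trans (Equiv.emptySum (Fin 0) K)

end FreeWithConstants

theorem theoremT :
    ∃ (C : Type) (_ : SmallCategory C) (t : C),
      Countable (Σ a b : C, a ⟶ b) ∧
      IsMcLartyTopos (C ⥤ Type) ∧
      IsAtomicObject (coyoneda.obj (Opposite.op t)) ∧
      (∀ (S : Type 1) (_ : Category.{0} S) (_ : IsElementaryTopos S) (_ : IsBoolean S)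
        (P : Precohesion (C ⥤ Type) S), P.IsConnected (coyoneda.obj (Opposite.op t))) ∧
      Nonempty ((⊤_ (C ⥤ Type) ⟶ coyoneda.obj (Opposite.op t)) ≃ ℕ) := by
  refine ⟨FreeWithConstants ℕ, inferInstance, ⟨1⟩, inferInstance, ?_, isAtomicObject_coyoneda _,
    ?_, ⟨?_⟩⟩
  -- All generators go to the constant `0`; any other constant would do.
  · exact isMcLartyTopos_of_isInitial FreeWithConstants.isInitialZero fun _ _ => Sum.inr 0
  · intro S _ _ hS P
    exact P.isConnected_coyoneda hS FreeWithConstants.isInitialZero fun _ => Sum.inr 0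
  · exact (terminalHomEquiv FreeWithConstants.isInitialZero _).trans
      FreeWithConstants.homOneZeroEquiv
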